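/- Let $m\ge 3$ and $n\ge 1$ be integers. A tensor $T\in\otimes^m(\mathbb{C}^{n+1})$ is identified with its coefficients $(t_{i_1\cdots i_m})_{0\le i_1,\dots,i_m\le n}$, and for $x\in\mathbb{C}^{n+1}$ let $Tx^{m-1}\in\mathbb{C}^{n+1}$ be the vector with entries $$(Tx^{m-1})_i=\sum_{i_2,\dots,i_m=0}^{n} t_{i\,i_2\cdots i_m}\,x_{i_2}\cdots x_{i_m},\qquad 0\le i\le n.$$ A vector $x\in\mathbb{C}^{n+1}\setminus\{0\}$ is called an eigenvector of $T$ if $Tx^{m-1}\wedge x=0$; this depends only on the point $[x]\in\mathbb{P}^n=\mathbb{P}(\mathbb{C}^{n+1})$. Theorem. Let $M\subset\mathbb{P}^n$ be a nonsingular projective variety of dimension $k<n$, that is, a nonempty Zariski closed subset (not necessarily irreducible) of dimension $k$ whose Zariski tangent spaces at all points have the same dimension. Then a generic tensor $T\in\otimes^m(\mathbb{C}^{n+1})$ has no eigenvectors on $M$: there is a nonempty Zariski open subset $U\subset\otimes^m(\mathbb{C}^{n+1})$, depending on $M$ and $m$, such that for every $T\in U$ and every eigenvector $x$ of $T$ we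 have $[x]\notin M$. -/

import Mathlib

noncomputable section

namespace TensorEigen

open MvPolynomial

/-- The vector space `ℂ ^ (n + 1)`, with coordinates indexed by `0, …, n`. -/
abbrev Vec (n : ℕ) : Type := Fin (n + 1) → ℂ

/-- Complex projective space `ℙ ^ n`, the space of lines through the origin in `ℂ ^ (n + 1)`. -/
abbrev ProjSpace (n : ℕ) : Type := Projectivization ℂ (Vec n)

/-! ### Tensors and their eigenvectors -/

/-- Tensors of order `m` and dimension `n + 1`, given by their coefficients `t_{i₁ … i_m}`. -/
abbrev Tensor (m n : ℕ) : Type := (Fin m → Fin (n + 1)) → ℂ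

/-- The vector `T x ^ (m - 1)`, whose `i`-th entry is
`∑_{i₂, …, i_m} t_{i i₂ … i_m} x_{i₂} ⋯ x_{i_m}`. (For order `0` it is set to `0`.) -/
def Tensor.apply {n : ℕ} : {m : ℕ} → Tensor m n → Vec n → Vec n
  | 0, _, _ => 0
  | d + 1, T, x => fun i =>
      ∑ J : Fin d → Fin (n + 1), T (Fin.cons i J) * ∏ j, x (J j)

/-- A nonzero vector `x` is an eigenvector of `T` if `T x ^ (m - 1) ∧ x = 0`. -/
def IsEigenvector {m n : ℕ} (T : Tensor m n) (x : Vec n) : Prop :=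
  x ≠ 0 ∧ ExteriorAlgebra.ι ℂ (T.apply x) * ExteriorAlgebra.ι ℂ x = 0

/-- A property of tensors holds generically if it holds on a nonempty Zariski open subset of the
affine space of tensors, i.e. outside a proper Zariski closed subset. -/
def Generically {m n : ℕ} (P : Tensor m n → Prop) : Prop :=
  ∃ I : Ideal (MvPolynomial (Fin m → Fin (n + 1)) ℂ),
    zeroLocus ℂ I ≠ Set.univ ∧ ∀ T : Tensor m n, T ∉ zeroLocus ℂ I → P T

/-! ### Projective varieties -/

/-- The common zero set in `ℙ ^ n` of a set of polynomials. It is used for homogeneous polynomials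
only, for which vanishing does not depend on the representative of the point. -/
def projZeroLocus {n : ℕ} (S : Set (MvPolynomial (Fin (n + 1)) ℂ)) : Set (ProjSpace n) :=
  {P | ∀ p ∈ S, eval P.rep p = 0}

/-- Projective algebraic sets: zero sets of families of homogeneous polynomials. -/
def IsProjAlgebraic {n : ℕ} (M : Set (ProjSpace n)) : Prop :=
  ∃ S : Set (MvPolynomial (Fin (n + 1)) ℂ),
    (∀ p ∈ S, ∃ d : ℕ, p.IsHomogeneous d) ∧ M = projZeroLocus S

/-- The Zariski topology on `ℙ ^ n`: the closed sets are the projective algebraic sets. -/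
instance zariskiTopology (n : ℕ) : TopologicalSpace (ProjSpace n) :=
  TopologicalSpace.ofClosed {M | IsProjAlgebraic M}
    ⟨{1}, by
      rintro p rfl
      exact ⟨0, isHomogeneous_one _ _⟩, by
      ext P
      simp [projZeroLocus]⟩
    (by
      intro A hA
      refine ⟨{p | (∃ d : ℕ, p.IsHomogeneous d) ∧ ∃ M ∈ A, ∀ P ∈ M, eval P.rep p = 0},
        fun p hp => hp.1, ?_⟩
      ext P
      constructor
      · rintro hP p ⟨-, M, hM, hp⟩
        exact hp P (hP M hM)
      · intro hP M hM
        obtain ⟨S, hS, rfl⟩ := hA hM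
        exact fun p hp => hP p ⟨hS p hp, _, hM, fun Q hQ => hQ p hp⟩)
    (by
      rintro M ⟨S, hS, rfl⟩ N ⟨S', hS', rfl⟩
      refine ⟨{r | ∃ p ∈ S, ∃ q ∈ S', r = p * q}, ?_, ?_⟩
      · rintro r ⟨p, hp, q, hq, rfl⟩
        obtain ⟨d, hd⟩ := hS p hp
        obtain ⟨e, he⟩ := hS' q hq
        exact ⟨d + e, hd.mul he⟩
      · ext P
        constructor
        · rintro (hP | hP) r ⟨p, hp, q, hq, rfl⟩
          · rw [map_mul, hP p hp, zero_mul]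
          · rw [map_mul, hP q hq, mul_zero]
        · intro hP
          by_contra hcon
          simp only [Set.mem_union, not_or, projZeroLocus, Set.mem_ofPred_eq, not_forall] at hcon
          obtain ⟨⟨p, hp, hp0⟩, ⟨q, hq, hq0⟩⟩ := hcon
          have h := hP (p * q) ⟨p, hp, q, hq, rfl⟩
          rw [map_mul] at h
          exact (mul_ne_zero hp0 hq0) h)

theorem isClosed_iff_isProjAlgebraic {n : ℕ} (M : Set (ProjSpace n)) :
    IsClosed M ↔ IsProjAlgebraic M := by
  rw [← isOpen_compl_iff]
  change IsProjAlgebraic Mᶜᶜ ↔ _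
  rw [compl_compl]

/-- The tangent space at `P.rep` of the affine cone over `M`: the common kernel of the
differentials of the homogeneous polynomials that vanish on `M`. -/
def coneTangentSpace {n : ℕ} (M : Set (ProjSpace n)) (P : ProjSpace n) : Submodule ℂ (Vec n) where
  carrier := {v | ∀ p : MvPolynomial (Fin (n + 1)) ℂ, (∃ d : ℕ, p.IsHomogeneous d) →
    (∀ Q ∈ M, eval Q.rep p = 0) → ∑ i, eval P.rep (pderiv i p) * v i = 0}
  zero_mem' := by
    intro p _ _
    simp
  add_mem' := by
    intro v w hv hw p hp hM
    simp only [Pi.add_apply, mul_add, Finset.sum_add_distrib, hv p hp hM, hw p hp hM, add_zero]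
  smul_mem' := by
    intro c v hv p hp hM
    have h : ∀ i, eval P.rep (pderiv i p) * (c • v) i
        = c * (eval P.rep (pderiv i p) * v i) := fun i => by
      simp only [Pi.smul_apply, smul_eq_mul]
      ring
    simp only [h, ← Finset.mul_sum, hv p hp hM, mul_zero]

/-- The (Zariski) tangent space of `M` at a point `P = [x]`: the tangent space of the affine cone
modulo the line `ℂ x`, inside `ℂ ^ (n + 1) / ℂ x`, the tangent space of `ℙ ^ n` at `P`. -/
def tangentSpace {n : ℕ} (M : Set (ProjSpace n)) (P : ProjSpace n) :
    Submodule ℂ (Vec n ⧸ P.submodule) :=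
  (coneTangentSpace M P).map P.submodule.mkQ

/-- A nonsingular projective variety in `ℙ ^ n` of dimension `k`: a Zariski closed set of Krull
dimension `k` whose tangent spaces all have the same dimension. It need not be irreducible, and it
is nonempty because its dimension is a natural number. -/
structure IsNonsingularProjVariety {n : ℕ} (M : Set (ProjSpace n)) (k : ℕ) : Prop where
  isClosed : IsClosed M
  dim_eq : topologicalKrullDim M = k
  finrank_tangentSpace_eq : ∀ P ∈ M, ∀ Q ∈ M,
    Module.finrank ℂ (tangentSpace M P) = Module.finrank ℂ (tangentSpace M Q)

end TensorEigen

end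

noncomputable section

namespace TensorEigen

open MvPolynomial

/-! ### Elimination theory -/

/-! Since `k < n`, `M` misses some point `P`, and some form `f` vanishes on `M` but not at `P`. It
suffices to avoid eigenvectors on the hypersurface `f = 0`. Having one there means that `f` and the
2 × 2 minors of `(T x ^ d, x)`, all homogeneous in `x`, have a nontrivial common zero. By
elimination (`exists_eliminant`), such `T` satisfy a polynomial equation `R = 0`, and `R` can be
chosen nonzero at any given tensor without such an eigenvector. A witness is a tensor whose only
eigenvector is `P` (`exists_tensor_eigenvector_unique`): a linear conjugate of the nilpotent-like
map `y ↦ (y₁ ^ d, …, y_n ^ d, 0)`. -/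

theorem _root_.MvPolynomial.IsHomogeneous.eval_smul_vec {σ R : Type*} [CommSemiring R]
    {f : MvPolynomial σ R} {d : ℕ} (hf : f.IsHomogeneous d) (c : R) (x : σ → R) :
    eval (c • x) f = c ^ d * eval x f := by
  rw [eval_eq, eval_eq, Finset.mul_sum]
  refine Finset.sum_congr rfl fun s hs => ?_
  have h : ∑ i ∈ s.support, s i = d := (hf.degree_eq_sum_deg_support hs).symm
  simp only [Pi.smul_apply, smul_eq_mul, mul_pow, Finset.prod_mul_distrib,
    Finset.prod_pow_eq_pow_sum, h]
  ring

-- An ideal with homogeneous generators contains the homogeneous components of its members.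
attribute [local instance] MvPolynomial.gradedAlgebra in
theorem eval_homogeneousComponent_eq_zero {σ ι K : Type*} [Field K]
    {p : ι → MvPolynomial σ K} (hp : ∀ i, ∃ d, (p i).IsHomogeneous d) {x : σ → K}
    (hx : ∀ i, eval x (p i) = 0) {q : MvPolynomial σ K} (hq : q ∈ Ideal.span (Set.range p))
    (D : ℕ) : eval x (homogeneousComponent D q) = 0 := by
  have hle : Ideal.span (Set.range p) ≤ RingHom.ker (eval x) := by
    rw [Ideal.span_le]
    rintro _ ⟨i, rfl⟩
    exact hx i
  refine hle (homogeneousComponent_mem_of_mem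
    (Ideal.homogeneous_span (homogeneousSubmodule σ K) _ ?_) hq D)
  rintro _ ⟨i, rfl⟩
  exact hp i

/-- If finitely many polynomials have only the trivial common zero, then the ideal they generate
contains all monomials of some degree. -/
theorem exists_degree_forall_monomial_mem_span {σ K : Type*} [Fintype σ] [Field K] [IsAlgClosed K]
    (S : Set (MvPolynomial σ K)) (h : ∀ x : σ → K, (∀ p ∈ S, eval x p = 0) → x = 0) :
    ∃ D : ℕ, ∀ a : σ →₀ ℕ, a.degree = D → monomial a 1 ∈ Ideal.span S := by
  -- Nullstellensatz: every variable vanishes on the zero locus, which lies in `{0}`.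
  have hrad : idealOfVars σ K ≤ (Ideal.span S).radical := by
    rw [← vanishingIdeal_zeroLocus_eq_radical (K := K), idealOfVars, Ideal.span_le]
    rintro _ ⟨i, rfl⟩ x hx
    have hx0 : x = 0 := h x fun p hp => by
      simpa [aeval_eq_eval] using hx p (Ideal.subset_span hp)
    simp [hx0]
  obtain ⟨D, hD⟩ := Ideal.exists_pow_le_of_le_radical_of_fg_radical hrad
    (IsNoetherian.noetherian _)
  exact ⟨D, fun a ha => hD ((monomial_mem_pow_idealOfVars_iff D a one_ne_zero).2 ha.ge)⟩

/-- The parameters for which a finite family of homogeneous polynomials with polynomial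
coefficients has a nontrivial common zero are contained in a hypersurface, which avoids any given
parameter for which there is no such zero. -/
theorem exists_eliminant {σ τ ι K : Type*} [Fintype σ] [Fintype ι] [Field K] [IsAlgClosed K]
    (p : ι → MvPolynomial σ (MvPolynomial τ K)) (hp : ∀ i, ∃ d, (p i).IsHomogeneous d)
    (t₀ : τ → K) (h₀ : ∀ x : σ → K, (∀ i, eval x (map (eval t₀) (p i)) = 0) → x = 0) :
    ∃ R : MvPolynomial τ K, eval t₀ R ≠ 0 ∧ ∀ (t : τ → K) (x : σ → K), x ≠ 0 →
      (∀ i, eval x (map (eval t) (p i)) = 0) → eval t R = 0 := by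
  classical
  obtain ⟨D, hD⟩ := exists_degree_forall_monomial_mem_span
    (Set.range fun i => map (eval t₀) (p i)) (by simpa using h₀)
  have hfin : Finite {a : σ →₀ ℕ // a.degree = D} :=
    Finite.of_injective
      (fun a : {a : σ →₀ ℕ // a.degree = D} => fun i : σ =>
        (⟨a.1 i, Nat.lt_succ_of_le ((Finsupp.le_degree i a.1).trans_eq a.2)⟩ : Fin (D + 1)))
      fun a b hab => Subtype.ext <| Finsupp.ext fun i => congrArg Fin.val (congrFun hab i)
  have := Fintype.ofFinite {a : σ →₀ ℕ // a.degree = D}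
  have hex : ∀ a : {a : σ →₀ ℕ // a.degree = D}, ∃ c : ι → MvPolynomial σ K,
      ∑ i, c i * map (eval t₀) (p i) = monomial a.1 1 := fun a =>
    Ideal.mem_span_range_iff_exists_fun.1 (hD a.1 a.2)
  choose c hc using hex
  -- Keep the multipliers `c` found at `t₀` and let the parameters of `p` vary. Then `q a`
  -- specializes to the monomial `a` at `t₀`, and the eliminant is the determinant of the degree `D`
  -- coefficients of the `q a`.
  let q : {a : σ →₀ ℕ // a.degree = D} → MvPolynomial σ (MvPolynomial τ K) := fun a =>
    ∑ i, map C (c a i) * p i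
  let Q : Matrix {a : σ →₀ ℕ // a.degree = D} {a : σ →₀ ℕ // a.degree = D} (MvPolynomial τ K) :=
    Matrix.of fun a b => coeff b.1 (q a)
  have hq : ∀ t a, map (eval t) (q a) = ∑ i, c a i * map (eval t) (p i) := by
    intro t a
    simp only [q, map_sum, map_mul, map_map]
    refine Finset.sum_congr rfl fun i _ => ?_
    congr 1
    convert! map_id (c a i)
    ext r
    simp
  refine ⟨Q.det, ?_, ?_⟩
  · rw [RingHom.map_det]
    have : (eval t₀).mapMatrix Q = 1 := by
      ext a b
      simp only [RingHom.mapMatrix_apply, Matrix.map_apply, Q, Matrix.of_apply]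
      rw [← coeff_map, hq, hc, coeff_monomial, Matrix.one_apply]
      simp [Subtype.ext_iff]
    simp [this]
  · intro t x hx hzero
    rw [RingHom.map_det, ← Matrix.exists_mulVec_eq_zero_iff]
    -- The degree `D` monomials evaluated at `x` form a kernel vector: row `a` yields the degree `D`
    -- part of `q a` at `x`. It is nonzero because some `x i ^ D` is.
    refine ⟨fun b => eval x (monomial b.1 1), ?_, ?_⟩
    · obtain ⟨i, hi⟩ := Function.ne_iff.1 hx
      refine Function.ne_iff.2 ⟨⟨Finsupp.single i D, by simp⟩, ?_⟩
      simpa [eval_monomial] using fun h => absurd h hi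
    · ext a
      have h1 : eval x (homogeneousComponent D (map (eval t) (q a))) = 0 := by
        refine eval_homogeneousComponent_eq_zero (p := fun i => map (eval t) (p i))
          (fun i => (hp i).imp fun d hd => hd.map _) hzero ?_ D
        rw [hq]
        exact Ideal.sum_mem _ fun i _ => Ideal.mul_mem_left _ _ (Ideal.subset_span ⟨i, rfl⟩)
      rw [eval_eq'] at h1
      rw [Pi.zero_apply, ← h1, Matrix.mulVec, dotProduct]
      symm
      have hsub : (homogeneousComponent D (map (eval t) (q a))).support ⊆
          Finset.univ.image (Subtype.val : {a : σ →₀ ℕ // a.degree = D} → σ →₀ ℕ) := by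
        intro s hs
        rw [mem_support_iff, coeff_homogeneousComponent] at hs
        simpa using fun h => hs (if_neg h)
      rw [Finset.sum_subset hsub fun s _ hs => by rw [notMem_support_iff.1 hs, zero_mul],
        Finset.sum_image Subtype.val_injective.injOn]
      refine Finset.sum_congr rfl fun b _ => ?_
      rw [coeff_homogeneousComponent, if_pos b.2, coeff_map, eval_monomial, one_mul,
        Finsupp.prod_fintype _ _ (by simp)]
      rfl

/-! ### The equations of eigenvectors -/

/-- A 2 × 2 minor is an alternating form, so it factors through the exterior algebra. -/
theorem mul_sub_mul_eq_zero_of_ι_mul_ι {σ K : Type*} [Field K] {a b : σ → K}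
    (h : ExteriorAlgebra.ι K a * ExteriorAlgebra.ι K b = 0) (i j : σ) :
    a i * b j - a j * b i = 0 := by
  let f : (σ → K) [⋀^Fin 2]→ₗ[K] K :=
    (Matrix.detRowAlternating (n := Fin 2) (R := K)).compLinearMap (LinearMap.funLeft K K ![i, j])
  have h2 : ExteriorAlgebra.ιMulti K 2 ![a, b] = 0 := by
    simpa [ExteriorAlgebra.ιMulti_apply] using h
  have h3 := ExteriorAlgebra.liftAlternating_apply_ιMulti
    (Function.update (0 : ∀ i, (σ → K) [⋀^Fin i]→ₗ[K] K) 2 f) ![a, b]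
  rw [h2, LinearMap.map_zero, Function.update_self] at h3
  have h4 : f ![a, b] = a i * b j - a j * b i := by
    refine (Matrix.det_fin_two
      (Matrix.of fun k : Fin 2 => LinearMap.funLeft K K ![i, j] (![a, b] k))).trans ?_
    simp [LinearMap.funLeft_apply]
  rw [← h4, ← h3]

/-- The entry `(T x ^ d)_i` for the generic tensor `T` of order `d + 1` and the generic vector
`x`. -/
def genericApply (d n : ℕ) (i : Fin (n + 1)) :
    MvPolynomial (Fin (n + 1)) (MvPolynomial (Fin (d + 1) → Fin (n + 1)) ℂ) :=
  ∑ J : Fin d → Fin (n + 1), C (X (Fin.cons i J)) * ∏ j, X (J j)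

theorem eval_map_genericApply {d n : ℕ} (T : Tensor (d + 1) n) (x : Vec n) (i : Fin (n + 1)) :
    eval x (map (eval T) (genericApply d n i)) = T.apply x i := by
  simp [genericApply, Tensor.apply]

theorem genericApply_isHomogeneous (d n : ℕ) (i : Fin (n + 1)) :
    (genericApply d n i).IsHomogeneous d := by
  refine IsHomogeneous.sum _ _ _ fun J _ => IsHomogeneous.C_mul ?_ _
  simpa using IsHomogeneous.prod Finset.univ (fun j => X (J j)) (fun _ => 1)
    fun j _ => isHomogeneous_X _ (J j)

/-- If some tensor has no eigenvector on the hypersurface `f = 0`, then a generic tensor has none.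
-/
theorem exists_eliminant_eigenvector {d n e : ℕ} {f : MvPolynomial (Fin (n + 1)) ℂ}
    (hf : f.IsHomogeneous e) (T₀ : Tensor (d + 1) n)
    (h₀ : ∀ x : Vec n, eval x f = 0 →
      (∀ i j, T₀.apply x i * x j - T₀.apply x j * x i = 0) → x = 0) :
    ∃ R : MvPolynomial (Fin (d + 1) → Fin (n + 1)) ℂ, eval T₀ R ≠ 0 ∧
      ∀ (T : Tensor (d + 1) n) (x : Vec n), IsEigenvector T x → eval x f = 0 → eval T R = 0 := by
  let p : Option (Fin (n + 1) × Fin (n + 1)) →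
      MvPolynomial (Fin (n + 1)) (MvPolynomial (Fin (d + 1) → Fin (n + 1)) ℂ) := fun o =>
    o.elim (map C f) fun ij => genericApply d n ij.1 * X ij.2 - genericApply d n ij.2 * X ij.1
  have hnone : ∀ (T : Tensor (d + 1) n) (x : Vec n),
      eval x (map (eval T) (p none)) = eval x f := by
    intro T x
    simp only [p, Option.elim_none, map_map]
    congr 1
    convert! map_id f
    ext r
    simp
  have hsome : ∀ (T : Tensor (d + 1) n) (x : Vec n) (i j : Fin (n + 1)),
      eval x (map (eval T) (p (some (i, j)))) = T.apply x i * x j - T.apply x j * x i := by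
    intro T x i j
    simp only [p, Option.elim_some, map_sub, map_mul, map_X, eval_X, eval_map_genericApply]
  obtain ⟨R, hR₀, hR⟩ := exists_eliminant p (by
    rintro (_ | ⟨i, j⟩)
    · exact ⟨e, hf.map _⟩
    · exact ⟨d + 1, ((genericApply_isHomogeneous d n i).mul (isHomogeneous_X _ j)).sub
        ((genericApply_isHomogeneous d n j).mul (isHomogeneous_X _ i))⟩) T₀ (by
    intro x hx
    refine h₀ x ?_ fun i j => ?_
    · rw [← hnone T₀ x]
      exact hx none
    · rw [← hsome T₀ x]
      exact hx _)
  refine ⟨R, hR₀, fun T x hx hfx => hR T x hx.1 ?_⟩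
  rintro (_ | ⟨i, j⟩)
  · rw [hnone, hfx]
  · rw [hsome]
    exact mul_sub_mul_eq_zero_of_ι_mul_ι hx.2 i j

/-! ### A tensor with a single eigenvector -/

/-- The map `x ↦ ∑ s, (L s ⬝ x) ^ d • c s` is given by a tensor. -/
theorem exists_tensor_apply_eq {d n : ℕ} {κ : Type*} [Fintype κ] (c : κ → Vec n) (L : κ → Vec n) :
    ∃ T : Tensor (d + 1) n, ∀ x, T.apply x = ∑ s, (L s ⬝ᵥ x) ^ d • c s := by
  -- The sum of the rank-one tensors `c s ⊗ L s ⊗ ⋯ ⊗ L s`.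
  refine ⟨fun I => ∑ s, c s (I 0) * ∏ j : Fin d, L s (I j.succ), fun x => ?_⟩
  ext i
  simp only [Tensor.apply, Fin.cons_zero, Fin.cons_succ, Finset.sum_apply, Pi.smul_apply,
    smul_eq_mul, dotProduct, Finset.sum_mul, Fintype.sum_pow, Finset.prod_mul_distrib]
  rw [Finset.sum_comm]
  exact Finset.sum_congr rfl fun s _ => Finset.sum_congr rfl fun J _ => by ring

/-- The map `y ↦ (y₁ ^ d, …, y_n ^ d, 0)` has the single eigenvector `(1, 0, …, 0)`. -/
theorem eq_smul_single_of_shift_eq_smul {d n : ℕ} (hd : d ≠ 0) {y : Vec n} {r : ℂ} (hy : y ≠ 0)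
    (hcast : ∀ s : Fin n, y s.succ ^ d = r * y s.castSucc) (hlast : r * y (Fin.last n) = 0) :
    y = y 0 • Pi.single 0 1 := by
  have hsucc : ∀ s : Fin n, y s.succ = 0 := by
    by_cases hr : r = 0
    · exact fun s => eq_zero_of_pow_eq_zero (n := d) (by rw [hcast, hr, zero_mul])
    -- For `r ≠ 0` the last coordinate vanishes, and the vanishing propagates downwards.
    · have h0 : ∀ s, y s = 0 := fun s => by
        induction s using Fin.reverseInduction with
        | last => exact (mul_eq_zero.1 hlast).resolve_left hr
        | cast s ih =>
          have := hcast s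
          rw [ih, zero_pow hd] at this
          exact (mul_eq_zero.1 this.symm).resolve_left hr
      exact absurd (funext h0) hy
  ext s
  refine Fin.cases ?_ (fun s => ?_) s
  · simp
  · simp [hsucc]

/-- Conjugate the shifted power map by a linear automorphism `e` taking the first basis vector to
`a`. -/
theorem exists_tensor_eigenvector_unique {d n : ℕ} (hd : d ≠ 0) {a : Vec n} (ha : a ≠ 0) :
    ∃ T : Tensor (d + 1) n, ∀ x : Vec n, x ≠ 0 →
      (∀ i j, T.apply x i * x j - T.apply x j * x i = 0) → ∃ c : ℂ, x = c • a := by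
  obtain ⟨e, he⟩ := SeparatingDual.exists_continuousLinearEquiv_apply_eq (R := ℂ)
    (x := (Pi.single 0 1 : Vec n)) (y := a) (by simp) ha
  obtain ⟨T, hT⟩ := exists_tensor_apply_eq (d := d) (fun s : Fin n => e (Pi.single s.castSucc 1))
    (fun s : Fin n => fun k => e.symm (Pi.single k 1) s.succ)
  refine ⟨T, fun x hx h => ?_⟩
  obtain ⟨j, hj⟩ := Function.ne_iff.1 hx
  rw [Pi.zero_apply] at hj
  have hr : T.apply x = (T.apply x j / x j) • x := by
    ext i
    rw [Pi.smul_apply, smul_eq_mul]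
    field_simp
    linear_combination h i j
  set r := T.apply x j / x j
  have hdot : ∀ s : Fin n, (fun k => e.symm (Pi.single k 1) s.succ) ⬝ᵥ x = e.symm x s.succ := by
    intro s
    conv_rhs => rw [← Finset.univ_sum_single x, map_sum, Finset.sum_apply]
    refine Finset.sum_congr rfl fun k _ => ?_
    rw [show (Pi.single k (x k) : Vec n) = x k • Pi.single k 1 by
      rw [← Pi.single_smul, smul_eq_mul, mul_one], map_smul, Pi.smul_apply, smul_eq_mul, mul_comm]
  have hy : ∑ s : Fin n, e.symm x s.succ ^ d • (Pi.single s.castSucc 1 : Vec n)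
      = r • e.symm x := by
    rw [← map_smul, ← hr, hT, map_sum]
    simp only [map_smul, hdot, ContinuousLinearEquiv.symm_apply_apply]
  refine ⟨e.symm x 0, ?_⟩
  have key := eq_smul_single_of_shift_eq_smul (r := r) (y := e.symm x) hd (by simpa using hx)
    (fun s => ?_) ?_
  · apply e.symm.injective
    rw [map_smul, ← he, ContinuousLinearEquiv.symm_apply_apply]
    exact key
  · have := congrFun hy s.castSucc
    simpa [Finset.sum_apply, Pi.single_apply] using this
  · have := congrFun hy (Fin.last n)
    simpa [Finset.sum_apply, Pi.single_apply, (Fin.castSucc_lt_last _).ne'] using this.symm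

/-! ### The dimension of projective space -/

theorem eval_rep_mk_eq_zero_iff {n d : ℕ} {f : MvPolynomial (Fin (n + 1)) ℂ}
    (hf : f.IsHomogeneous d) {x : Vec n} (hx : x ≠ 0) :
    eval (Projectivization.mk ℂ x hx).rep f = 0 ↔ eval x f = 0 := by
  obtain ⟨c, hc⟩ := Projectivization.exists_smul_eq_mk_rep ℂ x hx
  rw [← hc, Units.smul_def, hf.eval_smul_vec]
  simp

/-- The linear subspace of `ℙ ^ n` where all coordinates of index larger than `j` vanish. -/
def coordSubspace (n : ℕ) (j : Fin (n + 1)) : Set (ProjSpace n) :=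
  projZeroLocus {p | ∃ i, j < i ∧ p = X i}

theorem mem_coordSubspace {n : ℕ} {j : Fin (n + 1)} {P : ProjSpace n} :
    P ∈ coordSubspace n j ↔ ∀ i, j < i → P.rep i = 0 := by
  simp only [coordSubspace, projZeroLocus, Set.mem_ofPred_eq]
  constructor
  · intro h i hi
    simpa using h _ ⟨i, hi, rfl⟩
  · rintro h _ ⟨i, hi, rfl⟩
    simpa using h i hi

theorem mk_mem_coordSubspace {n : ℕ} {j : Fin (n + 1)} {x : Vec n} (hx : x ≠ 0) :
    Projectivization.mk ℂ x hx ∈ coordSubspace n j ↔ ∀ i, j < i → x i = 0 := by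
  rw [mem_coordSubspace]
  refine forall₂_congr fun i _ => ?_
  simpa using eval_rep_mk_eq_zero_iff (isHomogeneous_X ℂ i) hx

theorem isClosed_coordSubspace {n : ℕ} (j : Fin (n + 1)) : IsClosed (coordSubspace n j) := by
  rw [isClosed_iff_isProjAlgebraic]
  refine ⟨_, ?_, rfl⟩
  rintro _ ⟨i, -, rfl⟩
  exact ⟨1, isHomogeneous_X _ _⟩

theorem exists_homogeneous_of_notMem {n : ℕ} {M : Set (ProjSpace n)} (hM : IsClosed M)
    {P : ProjSpace n} (hP : P ∉ M) : ∃ (f : MvPolynomial (Fin (n + 1)) ℂ) (d : ℕ),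
      f.IsHomogeneous d ∧ eval P.rep f ≠ 0 ∧ ∀ Q ∈ M, eval Q.rep f = 0 := by
  obtain ⟨S, hS, rfl⟩ := (isClosed_iff_isProjAlgebraic M).1 hM
  simp only [projZeroLocus, Set.mem_ofPred_eq, not_forall] at hP
  obtain ⟨f, hfS, hf⟩ := hP
  obtain ⟨d, hd⟩ := hS f hfS
  exact ⟨f, d, hd, hf, fun Q hQ => hQ f hfS⟩

/-- Three polynomials that do not vanish identically on a line are simultaneously nonzero at some
point of it. -/
theorem exists_lineMap_eval_ne_zero {σ : Type*} {f g h : MvPolynomial σ ℂ} {x y : σ → ℂ}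
    (hf : eval x f ≠ 0) (hg : eval y g ≠ 0) (hh : eval x h ≠ 0) :
    ∃ s : ℂ, eval (x + s • (y - x)) f ≠ 0 ∧ eval (x + s • (y - x)) g ≠ 0 ∧
      eval (x + s • (y - x)) h ≠ 0 := by
  let φ : MvPolynomial σ ℂ →ₐ[ℂ] Polynomial ℂ :=
    aeval fun i => Polynomial.C (x i) + Polynomial.X * Polynomial.C (y i - x i)
  have hφ : ∀ (q : MvPolynomial σ ℂ) (s : ℂ), (φ q).eval s = eval (x + s • (y - x)) q := by
    intro q s
    have : ((Polynomial.aeval s).comp φ) = aeval (x + s • (y - x)) := by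
      ext i
      simp [φ]
    simpa [aeval_eq_eval] using DFunLike.congr_fun this q
  have hne : ∀ {q : MvPolynomial σ ℂ} (s : ℂ), eval (x + s • (y - x)) q ≠ 0 → φ q ≠ 0 :=
    fun s hq h0 => hq (by rw [← hφ, h0, Polynomial.eval_zero])
  have hprod : φ f * φ g * φ h ≠ 0 :=
    mul_ne_zero (mul_ne_zero (hne 0 (by simpa using hf)) (hne 1 (by simpa using hg)))
      (hne 0 (by simpa using hh))
  obtain ⟨s, hs⟩ : ∃ s, (φ f * φ g * φ h).eval s ≠ 0 := by
    by_contra! hcon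
    exact hprod (Polynomial.funext fun s => by rw [hcon, Polynomial.eval_zero])
  simp only [Polynomial.eval_mul, hφ, mul_ne_zero_iff] at hs
  exact ⟨s, hs.1.1, hs.1.2, hs.2⟩

/-- Given two nonempty open subsets, the line joining a point of each stays in the subspace, and all
but finitely many of its parameters give points in both. -/
theorem isIrreducible_coordSubspace {n : ℕ} (j : Fin (n + 1)) :
    IsIrreducible (coordSubspace n j) := by
  constructor
  · refine ⟨Projectivization.mk ℂ (Pi.single 0 1) (by simp), (mk_mem_coordSubspace _).2 ?_⟩
    intro i hi
    exact Pi.single_eq_of_ne (Fin.ne_zero_of_lt hi) _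
  · rintro U V hU hV ⟨P, hPj, hPU⟩ ⟨Q, hQj, hQV⟩
    obtain ⟨f, d, hf, hfP, hfU⟩ := exists_homogeneous_of_notMem hU.isClosed_compl (P := P)
      (by simpa using hPU)
    obtain ⟨g, e, hg, hgQ, hgV⟩ := exists_homogeneous_of_notMem hV.isClosed_compl (P := Q)
      (by simpa using hQV)
    obtain ⟨i, hi⟩ := Function.ne_iff.1 P.rep_nonzero
    -- The third polynomial `X i` keeps the vector on the line nonzero, so that it represents a
    -- point.
    obtain ⟨s, hsf, hsg, hsi⟩ := exists_lineMap_eval_ne_zero (h := X i) hfP hgQ (by simpa using hi)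
    set z : Vec n := P.rep + s • (Q.rep - P.rep) with hzdef
    have hz : z ≠ 0 := by
      intro h0
      rw [h0] at hsi
      simp at hsi
    refine ⟨Projectivization.mk ℂ z hz, (mk_mem_coordSubspace hz).2 fun i hi => ?_, ?_, ?_⟩
    · simp [hzdef, mem_coordSubspace.1 hPj i hi, mem_coordSubspace.1 hQj i hi]
    · by_contra hcon
      exact hsf ((eval_rep_mk_eq_zero_iff hf hz).1 (hfU _ hcon))
    · by_contra hcon
      exact hsg ((eval_rep_mk_eq_zero_iff hg hz).1 (hgV _ hcon))

theorem strictMono_coordSubspace (n : ℕ) : StrictMono (coordSubspace n) := by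
  intro j l hjl
  refine Set.ssubset_iff_subset_ne.2 ⟨fun P hP => ?_, fun heq => ?_⟩
  · exact mem_coordSubspace.2 fun i hi => mem_coordSubspace.1 hP i (hjl.trans hi)
  · have hl : (Pi.single l 1 : Vec n) ≠ 0 := by simp
    have hmem : Projectivization.mk ℂ _ hl ∈ coordSubspace n l :=
      (mk_mem_coordSubspace hl).2 fun i hi => Pi.single_eq_of_ne hi.ne' _
    rw [← heq, mk_mem_coordSubspace] at hmem
    simpa using hmem l hjl

/-- The coordinate subspaces form a chain of irreducible closed sets of length `n`. -/
theorem le_topologicalKrullDim_projSpace (n : ℕ) :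
    (n : WithBot ℕ∞) ≤ topologicalKrullDim (ProjSpace n) := by
  have hmono : StrictMono fun j : Fin (n + 1) =>
      (⟨coordSubspace n j, isIrreducible_coordSubspace j, isClosed_coordSubspace j⟩ :
        TopologicalSpace.IrreducibleCloseds (ProjSpace n)) :=
    fun _ _ h => strictMono_coordSubspace n h
  exact Order.le_krullDim_iff.2 ⟨LTSeries.mk n _ hmono, rfl⟩

theorem ne_univ_of_topologicalKrullDim_lt {n : ℕ} {M : Set (ProjSpace n)}
    (h : topologicalKrullDim M < n) : M ≠ Set.univ := by
  rintro rfl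
  refine h.not_ge ((le_topologicalKrullDim_projSpace n).trans ?_)
  exact (Homeomorph.Set.univ (ProjSpace n)).symm.isInducing.topologicalKrullDim_le

end TensorEigen

end

theorem mainTheorem4 (m n k : ℕ) (hm : 3 ≤ m) (hn : 1 ≤ n) (hk : k < n)
    (M : Set (TensorEigen.ProjSpace n)) (hM : TensorEigen.IsNonsingularProjVariety M k) :
    TensorEigen.Generically (fun T : TensorEigen.Tensor m n =>
      ∀ (x : TensorEigen.Vec n) (hx : TensorEigen.IsEigenvector T x),
        Projectivization.mk ℂ x hx.1 ∉ M) := by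
  obtain ⟨d, rfl⟩ : ∃ d, m = d + 1 := ⟨m - 1, by omega⟩
  obtain ⟨P, hP⟩ := (Set.ne_univ_iff_exists_notMem M).1
    (TensorEigen.ne_univ_of_topologicalKrullDim_lt (by rw [hM.dim_eq]; exact_mod_cast hk))
  obtain ⟨f, e, hf, hfP, hfM⟩ := TensorEigen.exists_homogeneous_of_notMem hM.isClosed hP
  obtain ⟨T₀, hT₀⟩ := TensorEigen.exists_tensor_eigenvector_unique (d := d) (by omega)
    P.rep_nonzero
  obtain ⟨R, hR₀, hR⟩ := TensorEigen.exists_eliminant_eigenvector hf T₀ (by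
    intro x hfx hx
    by_contra hx0
    -- A nonzero solution is a multiple of `P.rep`, where `f` does not vanish.
    obtain ⟨c, rfl⟩ := hT₀ x hx0 hx
    rw [hf.eval_smul_vec] at hfx
    have hc : c ≠ 0 := fun h => hx0 (by rw [h, zero_smul])
    exact (mul_ne_zero (pow_ne_zero e hc) hfP) hfx)
  refine ⟨Ideal.span {R}, ?_, ?_⟩
  · rw [MvPolynomial.zeroLocus_span, Set.ne_univ_iff_exists_notMem]
    exact ⟨T₀, by simpa [MvPolynomial.aeval_eq_eval] using hR₀⟩
  · intro T hT x hx hxM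
    refine hT ?_
    rw [MvPolynomial.zeroLocus_span]
    simpa [MvPolynomial.aeval_eq_eval] using
      hR T x hx ((TensorEigen.eval_rep_mk_eq_zero_iff hf hx.1).1 (hfM _ hxM))
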